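/- **Setting.** Let $d\ge 1$ be an integer, $\beta>0$, and let $\|\cdot\|$ be the Euclidean norm on $\mathbb{R}^d$. Let $\mu$ be a probability density on $\mathbb{R}^d$ and $f^*:\mathbb{R}^d\to\{\pm1\}$ a target function. Call $(\mu,f^*)$ *admissible* if $\mu$ is continuous at almost every $\mathbf{x}\in\mathbb{R}^d$, and almost every $\mathbf{x}\in\mathbb{R}^d$ has a neighborhood on which $f^*$ is constant. For $p\in(0,0.49)$ and $m\in\mathbb{N}$, the training set $S=(\mathbf{x}_i,y_i)_{i=1}^m$ consists of i.i.d. pairs, where $\mathbf{x}_i$ has density $\mu$ and, independently of $\mathbf{x}_i$, the label is flipped with probability $p$: $y_i=-f^*(\mathbf{x}_i)$ with probability $p$ and $y_i=f^*(\mathbf{x}_i)$ with probability $1-p$. The interpolating Nadaraya–Watson predictor is $\hat h_\beta(\mathbf{x})=y_i$ if $\mathbf{x}=\mathbf{x}_i$ for some $i$, and $\hat h_\beta(\mathbf{x})=\mathrm{sign}\big(\sum_{i=1}^m y_i/\|\mathbf{x}-\mathbf{x}_i\|^{\beta}\big)$ otherwise (with $\mathrm{sign}(0)=0$). Its expected clean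 error is $$\mathcal{L}_m(\hat h_\beta)=\mathbb{E}_S\Big[\Pr_{\mathbf{x}\sim\mu}\big[\hat h_\beta(\mathbf{x})\ne f^*(\mathbf{x})\big]\Big].$$ **Theorem.** There are functions $C_1,C_2:(1,\infty)\to(0,\infty)$ such that for every integer $d\ge1$, every $\beta>d$, every admissible pair $(\mu,f^*)$ on $\mathbb{R}^d$ and every $p\in(0,0.49)$, $$C_1(\beta/d)\,p^{c(\beta/d)}\;\le\;\liminf_{m\to\infty}\mathcal{L}_m(\hat h_\beta)\;\le\;\limsup_{m\to\infty}\mathcal{L}_m(\hat h_\beta)\;\le\;C_2(\beta/d)\,\log^{\frac{1}{1-d/\beta}}(1/p)\;p,$$ where $c(\alpha)=\left(\frac{8\cdot2^{\alpha}}{\alpha-1}\right)^{\frac1{\alpha-1}}>0$ for $\alpha>1$. Moreover, for every $d\ge 1$ and $\beta>d$, $\hat h_\beta$ exhibits tempered overfitting, that is: for no $p\in(0,0.49)$ does $\mathcal{L}_m(\hat h_\beta)\to0$ hold for all admissible $(\mu,f^*)$; and there is a nondecreasing continuous $\varphi:[0,1]\to[0,1]$ with $\varphi(0)=0$ such that $\limsup_{m\to\infty}\mathcal{L}_m(\hat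 h_\beta)\le\varphi(p)$ for all $p\in(0,0.49)$ and all admissible $(\mu,f^*)$. -/

import Mathlib

open MeasureTheory Filter Topology
open scoped ENNReal

noncomputable section

namespace NadarayaWatson

/-- `ℝ^d` with the Euclidean norm. -/
abbrev Space (d : ℕ) : Type := EuclideanSpace ℝ (Fin d)

/-- The interpolating Nadaraya–Watson predictor with parameter `β` for the labelled sample
`S = (x_i, y_i)_{i < m}`: at a sample point it returns the label of that point, elsewhere the sign
of `∑ i, y_i / ‖x - x_i‖ ^ β`. If a point occurs several times in the sample, the label of one of
the occurrences is returned; `sign 0 = 0`. -/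
def predictor {d m : ℕ} (β : ℝ) (S : Fin m → Space d × ℝ) (x : Space d) : ℝ :=
  open Classical in
  if h : ∃ i, x = (S i).1 then (S h.choose).2
  else Real.sign (∑ i, (S i).2 / ‖x - (S i).1‖ ^ β)

/-- `μ` is a probability density on `ℝ^d` with respect to Lebesgue measure. -/
structure IsDensity {d : ℕ} (μ : Space d → ℝ) : Prop where
  nonneg : ∀ x, 0 ≤ μ x
  integrable : Integrable μ
  integral_eq_one : ∫ x, μ x = 1

/-- The admissible pairs: `μ` is a probability density that is continuous at almost every point,
and `f` is a `±1`-valued target function that is constant on a neighbourhood of almost every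
point. -/
structure Admissible {d : ℕ} (μ f : Space d → ℝ) : Prop where
  isDensity : IsDensity μ
  label : ∀ x, f x = 1 ∨ f x = -1
  continuousAt : ∀ᵐ x, ContinuousAt μ x
  locallyConstant : ∀ᵐ x, ∀ᶠ z in 𝓝 x, f z = f x

/-- The distribution of the inputs, with density `μ`. -/
def inputLaw {d : ℕ} (μ : Space d → ℝ) : Measure (Space d) :=
  volume.withDensity fun x => ENNReal.ofReal (μ x)

/-- The law of the indicator of a label flip: `true` (flipped) with probability `p`, and `false`
with probability `1 - p`. -/
def flipLaw (p : ℝ) : Measure Bool :=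
  ENNReal.ofReal p • Measure.dirac true + ENNReal.ofReal (1 - p) • Measure.dirac false

/-- The law of `m` i.i.d. pairs of an input and an independent flip indicator. -/
def sampleLaw {d : ℕ} (μ : Space d → ℝ) (p : ℝ) (m : ℕ) : Measure (Fin m → Space d × Bool) :=
  Measure.pi fun _ => (inputLaw μ).prod (flipLaw p)

/-- The labelled sample: `y_i = -f (x_i)` if the `i`-th label is flipped, `y_i = f (x_i)`
otherwise. -/
def labelled {d m : ℕ} (f : Space d → ℝ) (ω : Fin m → Space d × Bool) : Fin m → Space d × ℝ :=
  fun i => ((ω i).1, if (ω i).2 then -f (ω i).1 else f (ω i).1)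

/-- The expected clean classification error for sample size `m`: the expectation over the noisy
training set `S` of the probability that the predictor trained on `S` differs from the target `f`
at an independent input. -/
def cleanError {d : ℕ} (β : ℝ) (μ f : Space d → ℝ) (p : ℝ) (m : ℕ) : ℝ≥0∞ :=
  ∫⁻ ω, inputLaw μ {x | predictor β (labelled f ω) x ≠ f x} ∂sampleLaw μ p m

/-- The exponent of the lower bound, as a function of the ratio `α = β / d`. -/
def lowerExponent (α : ℝ) : ℝ :=
  (8 * (2 : ℝ) ^ α / (α - 1)) ^ (1 / (α - 1))

/-- Benign overfitting at noise level `p`: the asymptotic clean error is `0` for every admissible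
density and target. -/
def IsBenign (d : ℕ) (β p : ℝ) : Prop :=
  ∀ μ f : Space d → ℝ, Admissible μ f → Tendsto (cleanError β μ f p) atTop (𝓝 0)

/-- Tempered overfitting: overfitting is not benign, and the asymptotic clean error is at most
`φ p`, uniformly over the admissible densities and targets, for some nondecreasing continuous
`φ : [0, 1] → [0, 1]` with `φ 0 = 0`. -/
def IsTempered (d : ℕ) (β : ℝ) : Prop :=
  (∀ p : ℝ, 0 < p → p < 0.49 → ¬ IsBenign d β p) ∧
  ∃ φ : ℝ → ℝ, Set.MapsTo φ (Set.Icc 0 1) (Set.Icc 0 1) ∧ MonotoneOn φ (Set.Icc 0 1) ∧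
    ContinuousOn φ (Set.Icc 0 1) ∧ φ 0 = 0 ∧
    ∀ p : ℝ, 0 < p → p < 0.49 → ∀ μ f : Space d → ℝ, Admissible μ f →
      limsup (cleanError β μ f p) atTop ≤ ENNReal.ofReal (φ p)

end NadarayaWatson

end

/-! Fix a point `x` with positive density at which `μ` is continuous and near which `f` is constant.
Measure the distance of a sample point by its `level` `U`, namely `μ x` times the volume of the ball
around `x` through it. Near `0` the level is uniform up to a factor two and independent of the label
flip, and up to a common factor the weight `‖x - x_i‖ ^ (-β)` is `U ^ (-α)` with `α = β / d > 1`.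
The dimension, density and target thus disappear, leaving a vote with heavy-tailed weights
(`IsNoisyVote`). At the natural scale `t / m`, the points of level above `t / m` have total expected
weight of order `m ^ α * t ^ (1 - α)` (`integral_tailWeight_le`), so a bounded number of nearest
points decides the vote.

Lower bound (`exists_forall_eventually_le`): with probability at least a constant times `p`, one
flipped point lies so close that it outweighs all others. This is linear in `p`, hence stronger than
the claimed power, because the exponent is at least `1` (`one_le_lowerExponent`).

Upper bound (`exists_forall_eventually_ge`): with `L = log (1 / p)`, except with probability of
order `p * L ^ (α / (α - 1))` there is a point at level `2 * L / m`, no flip up to a level of order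
`L ^ (α / (α - 1)) / m`, and the weight beyond is too small to overturn the vote.

Both bounds hold at almost every `x` for large `m`, with constants depending on `α` only. Fatou's
lemma and its reverse integrate them over `x` (`Admissible.cleanError_bounds`). -/

noncomputable section

namespace NadarayaWatson

/-! ### Mean of the truncated heavy-tailed weights. -/

section Tail

variable {E : Type*} {U : E → ℝ} {α : ℝ}

/-- The weight `U ^ (-α)`, truncated to the points where `U` is larger than `u`. -/
def tailWeight (U : E → ℝ) (α u : ℝ) : E → ℝ :=
  {e | u < U e}.indicator fun e => (U e ^ α)⁻¹

theorem tailWeight_nonneg {u : ℝ} (hu : 0 < u) (e : E) : 0 ≤ tailWeight U α u e := by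
  refine Set.indicator_nonneg (fun e he => ?_) e
  have : 0 < U e := hu.trans he
  positivity

theorem tailWeight_le {u : ℝ} (hα : 0 ≤ α) (hu : 0 < u) (e : E) :
    tailWeight U α u e ≤ (u ^ α)⁻¹ := by
  refine Set.indicator_apply_le' (fun he => ?_) (fun _ => by positivity)
  have he : u < U e := he
  gcongr

theorem tailWeight_of_lt {u : ℝ} {e : E} (he : u < U e) : tailWeight U α u e = (U e ^ α)⁻¹ :=
  Set.indicator_of_mem (s := {e | u < U e}) he _

variable [MeasurableSpace E] {ν : Measure E} [IsProbabilityMeasure ν]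

theorem measurable_tailWeight (hU : Measurable U) (u : ℝ) : Measurable (tailWeight U α u) :=
  ((hU.pow_const α).inv).indicator (measurableSet_lt measurable_const hU)

theorem integrable_of_measurable_of_mem_Icc {g : E → ℝ} {c : ℝ} (hg : Measurable g)
    (h0 : ∀ e, 0 ≤ g e) (hc : ∀ e, g e ≤ c) : Integrable g ν :=
  Integrable.of_bound hg.aestronglyMeasurable c
    (ae_of_all _ fun e => by rw [Real.norm_of_nonneg (h0 e)]; exact hc e)

theorem integrable_tailWeight (hU : Measurable U) (hα : 0 ≤ α) {u : ℝ} (hu : 0 < u) :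
    Integrable (tailWeight U α u) ν :=
  integrable_of_measurable_of_mem_Icc (measurable_tailWeight hU u) (tailWeight_nonneg hu)
    (tailWeight_le hα hu)

/-- The constant in the bound for the mean of `tailWeight`. -/
def tailConst (α : ℝ) : ℝ := 4 / (1 - 2 ^ (1 - α))

theorem two_rpow_lt_one (hα : 1 < α) : (2 : ℝ) ^ (1 - α) < 1 :=
  Real.rpow_lt_one_of_one_lt_of_neg (by norm_num) (by linarith)

theorem tailConst_pos (hα : 1 < α) : 0 < tailConst α :=
  div_pos (by norm_num) (by linarith [two_rpow_lt_one hα])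

/-- Dyadic induction: replacing `u` by `2 * u` drops points of mass at most `4 * u` and weight at
most `u ^ (-α)`, which costs `4 * u ^ (1 - α)`. These costs form a geometric series of ratio `2 ^ (1
- α) < 1`, whose sum is `tailConst α * u ^ (1 - α)`. Once `u ≥ ε / 2` the trivial bound on the
weight takes over. -/
theorem integral_tailWeight_le (hU : Measurable U) (hα : 1 < α) {ε : ℝ} (hε : 0 < ε)
    (hν : ∀ v, 0 < v → v ≤ ε → ν.real {e | U e ≤ v} ≤ 2 * v) {u : ℝ} (hu : 0 < u) :
    ∫ e, tailWeight U α u e ∂ν ≤ tailConst α * u ^ (1 - α) + ((ε / 2) ^ α)⁻¹ := by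
  have hα0 : 0 ≤ α := by linarith
  have key : ∀ n : ℕ, ∀ u : ℝ, 0 < u → ε / 2 ^ (n + 1) ≤ u →
      ∫ e, tailWeight U α u e ∂ν ≤ tailConst α * u ^ (1 - α) + ((ε / 2) ^ α)⁻¹ := by
    have base : ∀ u : ℝ, 0 < u → ε / 2 ≤ u →
        ∫ e, tailWeight U α u e ∂ν ≤ tailConst α * u ^ (1 - α) + ((ε / 2) ^ α)⁻¹ := by
      intro u hu h
      have h1 : ∫ e, tailWeight U α u e ∂ν ≤ ∫ _e, (u ^ α)⁻¹ ∂ν :=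
        integral_mono (integrable_tailWeight hU hα0 hu) (integrable_const _)
          (tailWeight_le hα0 hu)
      rw [integral_const] at h1
      simp only [probReal_univ, one_smul] at h1
      have h2 : (u ^ α)⁻¹ ≤ ((ε / 2) ^ α)⁻¹ := by gcongr
      have h3 : 0 ≤ tailConst α * u ^ (1 - α) :=
        mul_nonneg (tailConst_pos hα).le (by positivity)
      linarith
    intro n
    induction n with
    | zero => intro u hu h; exact base u hu (by simpa using h)
    | succ n ih =>
      intro u hu h
      by_cases hb : ε / 2 ≤ u
      · exact base u hu hb
      push Not at hb
      have h2 := ih (2 * u) (by positivity) (by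
        rw [pow_succ] at h
        calc ε / 2 ^ (n + 1) = 2 * (ε / (2 ^ (n + 1) * 2)) := by field_simp
          _ ≤ 2 * u := by gcongr)
      have hms : MeasurableSet {e | U e ≤ 2 * u} := measurableSet_le hU measurable_const
      have hpt : ∀ e, tailWeight U α u e ≤
          tailWeight U α (2 * u) e + {e | U e ≤ 2 * u}.indicator (fun _ => (u ^ α)⁻¹) e := by
        intro e
        by_cases he : U e ≤ 2 * u
        · rw [Set.indicator_of_mem (s := {e | U e ≤ 2 * u}) he]
          linarith [tailWeight_le (U := U) hα0 hu e,
            tailWeight_nonneg (U := U) (α := α) (u := 2 * u) (by positivity) e]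
        · rw [Set.indicator_of_notMem (s := {e | U e ≤ 2 * u}) he, add_zero]
          push Not at he
          rw [tailWeight_of_lt he, tailWeight_of_lt (by linarith)]
      have hi2 := integrable_tailWeight (ν := ν) (α := α) hU hα0 (u := 2 * u) (by positivity)
      have hi3 : Integrable ({e | U e ≤ 2 * u}.indicator (fun _ => (u ^ α)⁻¹)) ν :=
        (integrable_const _).indicator hms
      have h1 := integral_mono (integrable_tailWeight hU hα0 hu) (hi2.add hi3) hpt
      rw [integral_add' hi2 hi3, integral_indicator_const _ hms, smul_eq_mul] at h1
      have h4 := hν (2 * u) (by positivity) (by linarith)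
      have h5 : ν.real {e | U e ≤ 2 * u} * (u ^ α)⁻¹ ≤ 2 * (2 * u) * (u ^ α)⁻¹ := by gcongr
      have h6 : u * (u ^ α)⁻¹ = u ^ (1 - α) := by
        rw [Real.rpow_sub hu, Real.rpow_one]; rfl
      have h7 : (2 * u) ^ (1 - α) = 2 ^ (1 - α) * u ^ (1 - α) :=
        Real.mul_rpow (by norm_num) hu.le
      have h8 : tailConst α = 4 + tailConst α * 2 ^ (1 - α) := by
        have := two_rpow_lt_one hα
        unfold tailConst
        have : 1 - (2 : ℝ) ^ (1 - α) ≠ 0 := by linarith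
        field_simp
        ring
      rw [h7] at h2
      calc _ ≤ _ := h1
        _ ≤ tailConst α * (2 ^ (1 - α) * u ^ (1 - α)) + ((ε / 2) ^ α)⁻¹
            + 4 * (u * (u ^ α)⁻¹) := by linarith
        _ = (4 + tailConst α * 2 ^ (1 - α)) * u ^ (1 - α) + ((ε / 2) ^ α)⁻¹ := by rw [h6]; ring
        _ = _ := by rw [← h8]
  obtain ⟨n, hn⟩ := pow_unbounded_of_one_lt (ε / u) (one_lt_two)
  refine key n u hu ?_
  rw [div_le_iff₀ (by positivity)]
  rw [div_lt_iff₀ hu] at hn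
  rw [pow_succ]
  nlinarith

end Tail

/-! ### Union, Markov and Chernoff bounds for i.i.d. samples. -/

section Sample

variable {E : Type*} [MeasurableSpace E] {ν : Measure E} [IsProbabilityMeasure ν]

theorem pi_real_eval_preimage {m : ℕ} (i : Fin m) {s : Set E} (hs : MeasurableSet s) :
    (Measure.pi fun _ : Fin m => ν).real {ω | ω i ∈ s} = ν.real s :=
  measureReal_def _ _ ▸ measureReal_def ν s ▸
    congrArg ENNReal.toReal ((measurePreserving_eval (fun _ : Fin m => ν) i).measure_preimage
      hs.nullMeasurableSet)

theorem pi_real_exists_le {m : ℕ} {s : Set E} (hs : MeasurableSet s) :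
    (Measure.pi fun _ : Fin m => ν).real {ω | ∃ i, ω i ∈ s} ≤ m * ν.real s := by
  have : {ω : Fin m → E | ∃ i, ω i ∈ s} = ⋃ i, {ω | ω i ∈ s} := by ext; simp
  rw [this]
  refine (measureReal_iUnion_fintype_le _).trans ?_
  simp [pi_real_eval_preimage _ hs]

theorem pi_real_forall_notMem_le {m : ℕ} {s : Set E} (hs : MeasurableSet s) :
    (Measure.pi fun _ : Fin m => ν).real {ω | ∀ i, ω i ∉ s} ≤ Real.exp (-(m * ν.real s)) := by
  have : {ω : Fin m → E | ∀ i, ω i ∉ s} = Set.univ.pi fun _ => sᶜ := by ext; simp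
  rw [this, measureReal_def, Measure.pi_pi, ENNReal.toReal_prod]
  simp only [Finset.prod_const, Finset.card_univ, Fintype.card_fin, ← measureReal_def]
  rw [probReal_compl_eq_one_sub hs, ← mul_neg, Real.exp_nat_mul]
  exact pow_le_pow_left₀ (by linarith [measureReal_le_one (μ := ν) (s := s)])
    (by linarith [Real.add_one_le_exp (-ν.real s)]) m

variable {g : E → ℝ}

theorem integral_sum_eval {m : ℕ} (hg : Integrable g ν) :
    Integrable (fun ω : Fin m → E => ∑ i, g (ω i)) (Measure.pi fun _ => ν) ∧
    ∫ ω : Fin m → E, ∑ i, g (ω i) ∂(Measure.pi fun _ => ν) = m * ∫ e, g e ∂ν := by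
  have hi : ∀ i : Fin m, Integrable (fun ω : Fin m → E => g (ω i)) (Measure.pi fun _ => ν) :=
    fun i => (measurePreserving_eval (fun _ : Fin m => ν) i).integrable_comp_of_integrable hg
  refine ⟨integrable_finsetSum _ fun i _ => hi i, ?_⟩
  rw [integral_finsetSum _ fun i _ => hi i]
  have he : ∀ i : Fin m, ∫ ω : Fin m → E, g (ω i) ∂(Measure.pi fun _ => ν) = ∫ e, g e ∂ν := by
    intro i
    have hp := measurePreserving_eval (fun _ : Fin m => ν) i
    refine (integral_map hp.measurable.aemeasurable ?_).symm.trans (by rw [hp.map_eq])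
    rw [hp.map_eq]
    exact hg.aestronglyMeasurable
  simp [he]

theorem pi_real_le_sum_le_div {m : ℕ} (hg : Integrable g ν) (h0 : ∀ e, 0 ≤ g e) {θ : ℝ}
    (hθ : 0 < θ) :
    (Measure.pi fun _ : Fin m => ν).real {ω | θ ≤ ∑ i, g (ω i)} ≤ m * (∫ e, g e ∂ν) / θ := by
  obtain ⟨h1, h2⟩ := integral_sum_eval (m := m) hg
  rw [le_div_iff₀ hθ, ← h2, mul_comm]
  exact mul_meas_ge_le_integral_of_nonneg
    (ae_of_all _ fun ω => Finset.sum_nonneg fun i _ => h0 _) h1 θ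

/-- A Chernoff bound for sums of independent copies of a bounded nonnegative function. -/
theorem pi_real_le_sum_le_exp {m : ℕ} (hg : Measurable g) {c : ℝ} (hc : 0 < c)
    (h0 : ∀ e, 0 ≤ g e) (hgc : ∀ e, g e ≤ c) {θ : ℝ} (hθ : m * ∫ e, g e ∂ν ≤ θ / 4) :
    (Measure.pi fun _ : Fin m => ν).real {ω | θ ≤ ∑ i, g (ω i)} ≤ Real.exp (-(θ / (2 * c))) := by
  set P := Measure.pi fun _ : Fin m => ν
  have hgi : Integrable g ν := integrable_of_measurable_of_mem_Icc hg h0 hgc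
  let X : Fin m → (Fin m → E) → ℝ := fun i ω => g (ω i)
  have hX : ∀ i, Measurable (X i) := fun i => hg.comp (measurable_pi_apply i)
  have hind : ProbabilityTheory.iIndepFun X P :=
    ProbabilityTheory.iIndepFun_pi fun _ => hg.aemeasurable
  have hsum : (fun ω : Fin m → E => ∑ i, g (ω i)) = ∑ i, X i := by ext ω; simp [X]
  have hmgf : ∀ i, ProbabilityTheory.mgf (X i) P (1 / c) ≤ Real.exp (2 * (∫ e, g e ∂ν) / c) := by
    intro i
    have hp := measurePreserving_eval (fun _ : Fin m => ν) i
    have hmeas : Measurable fun e => Real.exp (1 / c * g e) := by fun_prop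
    have h1 : ProbabilityTheory.mgf (X i) P (1 / c) = ∫ e, Real.exp (1 / c * g e) ∂ν := by
      rw [ProbabilityTheory.mgf]
      conv_rhs => rw [← hp.map_eq, integral_map hp.measurable.aemeasurable
        hmeas.aestronglyMeasurable]
    -- The bound `exp x ≤ 1 + 2 * x` on `[0, 1]`, from `|exp x - 1 - x| ≤ x ^ 2`. Taking the
    -- exponential moment at `1 / c` puts the argument in this interval.
    have hpt : ∀ e, Real.exp (1 / c * g e) ≤ 1 + 2 / c * g e := by
      intro e
      have hx0 : 0 ≤ g e / c := div_nonneg (h0 e) hc.le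
      have hx1 : g e / c ≤ 1 := (div_le_one hc).2 (hgc e)
      have h3 := (abs_le.1 (Real.abs_exp_sub_one_sub_id_le (abs_le.2 ⟨by linarith, hx1⟩))).2
      have : (g e / c) ^ 2 ≤ g e / c := by nlinarith
      calc Real.exp (1 / c * g e) = Real.exp (g e / c) := by ring_nf
        _ ≤ 1 + 2 * (g e / c) := by linarith
        _ = _ := by ring
    have hint : Integrable (fun e => Real.exp (1 / c * g e)) ν :=
      integrable_of_measurable_of_mem_Icc (c := 1 + 2 / c * c) hmeas
        (fun e => (Real.exp_pos _).le) fun e => (hpt e).trans (by gcongr; exact hgc e)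
    rw [h1]
    calc ∫ e, Real.exp (1 / c * g e) ∂ν ≤ ∫ e, (1 + 2 / c * g e) ∂ν :=
          integral_mono hint ((integrable_const _).add (hgi.const_mul _)) hpt
      _ = 2 * (∫ e, g e ∂ν) / c + 1 := by
          rw [integral_add (integrable_const _) (hgi.const_mul _), integral_const_mul]
          simp; ring
      _ ≤ _ := Real.add_one_le_exp _
  have hint : Integrable (fun ω => Real.exp (1 / c * (∑ i, X i) ω)) P := by
    refine integrable_of_measurable_of_mem_Icc (c := Real.exp (1 / c * (m * c))) ?_
      (fun e => (Real.exp_pos _).le) fun ω => ?_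
    · rw [← hsum]
      fun_prop
    · gcongr
      rw [Finset.sum_apply]
      refine (Finset.sum_le_sum fun i _ => hgc (ω i)).trans ?_
      simp
  have h := ProbabilityTheory.measure_ge_le_exp_mul_mgf (μ := P) (X := ∑ i, X i) (t := 1 / c) θ
    (by positivity) hint
  rw [hind.mgf_sum hX] at h
  have hset : {ω : Fin m → E | θ ≤ ∑ i, g (ω i)} = {ω | θ ≤ (∑ i, X i) ω} := by
    ext ω; simp [X]
  rw [hset]
  refine h.trans ?_
  have hprod : ∏ i, ProbabilityTheory.mgf (X i) P (1 / c) ≤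
      Real.exp (m * (2 * (∫ e, g e ∂ν) / c)) := by
    refine (Finset.prod_le_prod (fun i _ => ProbabilityTheory.mgf_nonneg)
      fun i _ => hmgf i).trans ?_
    simp [← Real.exp_nat_mul]
  calc _ ≤ Real.exp (-(1 / c) * θ) * Real.exp (m * (2 * (∫ e, g e ∂ν) / c)) := by gcongr
    _ = Real.exp ((2 * (m * ∫ e, g e ∂ν) - θ) / c) := by rw [← Real.exp_add]; ring_nf
    _ ≤ Real.exp ((2 * (θ / 4) - θ) / c) := by gcongr
    _ = _ := by congr 1; field_simp; ring

end Sample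

/-! ### Failure probability of a noisy weighted vote. -/

section Vote

variable {E : Type*} [MeasurableSpace E] {ν : Measure E} [IsProbabilityMeasure ν]
  {U z : E → ℝ} {α : ℝ} {F : Set E}

/-- A lower bound for the probability that a weighted vote fails: it fails if one of the sample
points is flipped and its weight dominates the weights of all others. -/
theorem le_pi_real_sum_nonpos (hU : Measurable U) (hα : 1 < α)
    (hz : ∀ e, |z e| ≤ (U e ^ α)⁻¹) (hF : MeasurableSet F) {v a : ℝ} (hv : 0 < v) (hva : v ≤ a)
    (hzF : ∀ e ∈ F, U e ≤ v → z e = -(U e ^ α)⁻¹) {n : ℕ}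
    (hnear : n * ν.real {e | U e ≤ a} ≤ 1 / 4)
    (hfar : n * ∫ e, tailWeight U α a e ∂ν ≤ (v ^ α)⁻¹ / 4) :
    (n + 1) * ν.real {e | e ∈ F ∧ 0 < U e ∧ U e ≤ v} / 2 ≤
      (Measure.pi fun _ : Fin (n + 1) => ν).real {ω | ∑ i, z (ω i) ≤ 0} := by
  have ha : 0 < a := hv.trans_le hva
  have hα0 : 0 ≤ α := by linarith
  have hθ : 0 < (v ^ α)⁻¹ := by positivity
  -- Positivity of the level matters: at level `0` the inverse power is `0` by convention, so such a
  -- point would carry no weight.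
  set A := {e | e ∈ F ∧ 0 < U e ∧ U e ≤ v} with hA
  have hAm : MeasurableSet A :=
    hF.inter ((measurableSet_lt measurable_const hU).inter (measurableSet_le hU measurable_const))
  have hTm := measurable_tailWeight (α := α) hU a
  have hUa : MeasurableSet {e | U e ≤ a} := measurableSet_le hU measurable_const
  let B₁ : Set (Fin n → E) := {ω | ∃ j, ω j ∈ {e | U e ≤ a}}
  let B₂ : Set (Fin n → E) := {ω | (v ^ α)⁻¹ ≤ ∑ j, tailWeight U α a (ω j)}
  have hB₁ : MeasurableSet B₁ := by
    have : B₁ = ⋃ j, {ω | ω j ∈ {e | U e ≤ a}} := by ext; simp [B₁]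
    rw [this]
    exact MeasurableSet.iUnion fun j => measurable_pi_apply j hUa
  have hB₂ : MeasurableSet B₂ := by
    refine measurableSet_le measurable_const ?_
    exact Finset.measurable_sum _ fun j _ => hTm.comp (measurable_pi_apply j)
  let B : Set (Fin n → E) := (B₁ ∪ B₂)ᶜ
  have hB : MeasurableSet B := (hB₁.union hB₂).compl
  have hPB : 1 / 2 ≤ (Measure.pi fun _ : Fin n => ν).real B := by
    have h1 : (Measure.pi fun _ : Fin n => ν).real B₁ ≤ 1 / 4 :=
      (pi_real_exists_le hUa).trans hnear
    have h2 : (Measure.pi fun _ : Fin n => ν).real B₂ ≤ 1 / 4 := by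
      refine (pi_real_le_sum_le_div (integrable_tailWeight hU hα0 ha)
        (tailWeight_nonneg ha) hθ).trans ?_
      rw [div_le_iff₀ hθ]
      linarith
    rw [probReal_compl_eq_one_sub (hB₁.union hB₂)]
    linarith [measureReal_union_le (μ := Measure.pi fun _ : Fin n => ν) B₁ B₂]
  -- The event that point `i` is the dominating flip while all others lie beyond level `a` with
  -- small total weight. These events exclude one another, so their probabilities add up and produce
  -- the factor `n + 1`.
  let D : Fin (n + 1) → Set (Fin (n + 1) → E) := fun i =>
    MeasurableEquiv.piFinSuccAbove (fun _ => E) i ⁻¹' (A ×ˢ B)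
  have hDm : ∀ i, MeasurableSet (D i) := fun i =>
    (MeasurableEquiv.measurable _) (hAm.prod hB)
  have hDP : ∀ i, (Measure.pi fun _ : Fin (n + 1) => ν).real (D i) =
      ν.real A * (Measure.pi fun _ : Fin n => ν).real B := by
    intro i
    rw [measureReal_def, (measurePreserving_piFinSuccAbove (fun _ => ν) i).measure_preimage
      (hAm.prod hB).nullMeasurableSet, Measure.prod_prod, ENNReal.toReal_mul]
    rfl
  have hDmem : ∀ i ω, ω ∈ D i ↔ ω i ∈ A ∧ (fun j => ω (i.succAbove j)) ∈ B := by
    intro i ω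
    rfl
  have hfarU : ∀ i ω, ω ∈ D i → ∀ j, a < U (ω (i.succAbove j)) := by
    intro i ω hω j
    by_contra! hcon
    exact ((hDmem i ω).1 hω).2 (Or.inl ⟨j, hcon⟩)
  have hdisj : Pairwise (Function.onFun Disjoint D) := by
    intro i j hij
    refine Set.disjoint_left.2 fun ω hi hj => ?_
    obtain ⟨k, hk⟩ := Fin.exists_succAbove_eq hij.symm
    have h1 := hfarU i ω hi k
    rw [hk] at h1
    have h2 : U (ω j) ≤ v := ((hDmem j ω).1 hj).1.2.2
    linarith
  have hsub : ⋃ i, D i ⊆ {ω | ∑ i, z (ω i) ≤ 0} := by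
    refine Set.iUnion_subset fun i ω hω => ?_
    obtain ⟨⟨hiF, hi0, hiv⟩, hB'⟩ := (hDmem i ω).1 hω
    have h1 : (v ^ α)⁻¹ ≤ (U (ω i) ^ α)⁻¹ := by gcongr
    have h2 : ∑ j, tailWeight U α a (ω (i.succAbove j)) < (v ^ α)⁻¹ := by
      by_contra! hcon
      exact hB' (Or.inr hcon)
    have h3 : ∑ j, z (ω (i.succAbove j)) ≤ ∑ j, tailWeight U α a (ω (i.succAbove j)) := by
      refine Finset.sum_le_sum fun j _ => ?_
      rw [tailWeight_of_lt (hfarU i ω hω j)]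
      exact (le_abs_self _).trans (hz _)
    rw [Set.mem_ofPred_eq, Fin.sum_univ_succAbove _ i, hzF _ hiF hiv]
    linarith
  calc (n + 1) * ν.real A / 2 = ∑ _i : Fin (n + 1), ν.real A * (1 / 2) := by
        simp; ring
    _ ≤ ∑ i, (Measure.pi fun _ : Fin (n + 1) => ν).real (D i) := by
        refine Finset.sum_le_sum fun i _ => ?_
        rw [hDP]
        gcongr
    _ = (Measure.pi fun _ : Fin (n + 1) => ν).real (⋃ i, D i) :=
        (measureReal_iUnion_fintype hdisj hDm).symm
    _ ≤ _ := measureReal_mono hsub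

/-- An upper bound for the probability that a weighted vote fails: it succeeds if there are no
flips at level `u`, there is a point at level `s ≤ u`, and the total weight above the level `u` is
smaller than the weight at level `s`. -/
theorem pi_real_sum_nonpos_le (hU : Measurable U) (hα : 1 < α)
    (hz : ∀ e, |z e| ≤ (U e ^ α)⁻¹) (hF : MeasurableSet F) {s u : ℝ} (hs : 0 < s) (hsu : s ≤ u)
    (hzF : ∀ e ∉ F, U e ≤ u → z e = (U e ^ α)⁻¹) {m : ℕ}
    (hfar : m * ∫ e, tailWeight U α u e ∂ν ≤ (s ^ α)⁻¹ / 4) :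
    (Measure.pi fun _ : Fin m => ν).real {ω | ∑ i, z (ω i) ≤ 0} ≤
      m * ν.real {e | e ∈ F ∧ U e ≤ u} + Real.exp (-(m * ν.real {e | 0 < U e ∧ U e ≤ s}))
        + Real.exp (-((s ^ α)⁻¹ / (2 * (u ^ α)⁻¹))) := by
  have hu : 0 < u := hs.trans_le hsu
  have hα0 : 0 ≤ α := by linarith
  have hsub : {ω : Fin m → E | ∑ i, z (ω i) ≤ 0} ⊆
      ({ω | ∃ i, ω i ∈ {e | e ∈ F ∧ U e ≤ u}} ∪ {ω | ∀ i, ω i ∉ {e | 0 < U e ∧ U e ≤ s}}) ∪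
        {ω | (s ^ α)⁻¹ ≤ ∑ i, tailWeight U α u (ω i)} := by
    intro ω hω
    by_contra hcon
    simp only [Set.mem_union, Set.mem_ofPred_eq, not_or, not_exists, not_and, not_forall,
      not_le, not_lt] at hcon
    obtain ⟨⟨h1, i, hi0, his⟩, h3⟩ := hcon
    -- Adding its truncated weight makes every vote nonnegative: up to level `u` all votes are
    -- correct, and beyond it the truncated weight is the full weight. The sum is therefore at least
    -- the single term of the point at level `s`.
    have hnonneg : ∀ j, 0 ≤ z (ω j) + tailWeight U α u (ω j) := by
      intro j
      by_cases hj : U (ω j) ≤ u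
      · have hjF : ω j ∉ F := fun h => absurd hj (not_le.2 (h1 j h))
        have := tailWeight_nonneg (U := U) (α := α) hu (ω j)
        have h4 := (abs_nonneg _).trans (hz (ω j))
        rw [hzF _ hjF hj]
        linarith
      · rw [tailWeight_of_lt (not_le.1 hj)]
        linarith [(abs_le.1 (hz (ω j))).1]
    have hiF : ω i ∉ F := fun h => absurd (his.trans hsu) (not_le.2 (h1 i h))
    have h5 : (s ^ α)⁻¹ ≤ z (ω i) + tailWeight U α u (ω i) := by
      rw [hzF _ hiF (his.trans hsu)]
      have h6 : (s ^ α)⁻¹ ≤ (U (ω i) ^ α)⁻¹ := by gcongr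
      linarith [tailWeight_nonneg (U := U) (α := α) hu (ω i)]
    have h7 := Finset.single_le_sum (f := fun j => z (ω j) + tailWeight U α u (ω j))
      (fun j _ => hnonneg j) (Finset.mem_univ i)
    rw [Finset.sum_add_distrib] at h7
    have hω : ∑ i, z (ω i) ≤ 0 := hω
    linarith
  have hFm : MeasurableSet {e | e ∈ F ∧ U e ≤ u} :=
    hF.inter (measurableSet_le hU measurable_const)
  have hSm : MeasurableSet {e | 0 < U e ∧ U e ≤ s} :=
    (measurableSet_lt measurable_const hU).inter (measurableSet_le hU measurable_const)
  refine (measureReal_mono hsub).trans <| (measureReal_union_le _ _).trans <|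
    add_le_add ((measureReal_union_le _ _).trans <|
      add_le_add (pi_real_exists_le hFm) (pi_real_forall_notMem_le hSm)) ?_
  exact pi_real_le_sum_le_exp (measurable_tailWeight hU u) (by positivity)
    (tailWeight_nonneg hu) (tailWeight_le hα0 hu) hfar

/-- The first term scales exactly like `m ^ α` and takes half of `r`. The constant `C` contributes
only `C * m`, which is of lower order as `α > 1` and fits into the other half. -/
theorem eventually_mul_rescaled_le {K C t r : ℝ} (hα : 1 < α) (ht : 0 < t) (hr : 0 < r)
    (h : K * t ^ (1 - α) ≤ r / 2) :
    ∀ᶠ m : ℕ in atTop, (m : ℝ) * (K * (t / m) ^ (1 - α) + C) ≤ r * (m : ℝ) ^ α := by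
  have h1 : Tendsto (fun m : ℕ => (m : ℝ) ^ (α - 1)) atTop atTop :=
    (tendsto_rpow_atTop (by linarith)).comp tendsto_natCast_atTop_atTop
  filter_upwards [h1.eventually_ge_atTop (2 * C / r), eventually_gt_atTop 0] with m hm hm0
  have hm0 : (0 : ℝ) < m := by exact_mod_cast hm0
  have h2 : (m : ℝ) ^ α = m * (m : ℝ) ^ (α - 1) := by
    rw [Real.rpow_sub_one hm0.ne']
    field_simp
  have h3 : (t / m) ^ (1 - α) = t ^ (1 - α) * (m : ℝ) ^ (α - 1) := by
    rw [Real.div_rpow ht.le hm0.le, div_eq_mul_inv, ← Real.rpow_neg hm0.le]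
    congr 2; ring
  rw [div_le_iff₀ hr] at hm
  rw [h2, h3]
  have h4 : K * t ^ (1 - α) * (m : ℝ) ^ (α - 1) ≤ r / 2 * (m : ℝ) ^ (α - 1) := by gcongr
  have h5 : K * (t ^ (1 - α) * (m : ℝ) ^ (α - 1)) + C ≤ r * (m : ℝ) ^ (α - 1) := by linarith
  calc _ ≤ (m : ℝ) * (r * (m : ℝ) ^ (α - 1)) := by gcongr
    _ = _ := by ring

/-- A vote with weights `U ^ (-α)` in which the votes at small `U` are correct off the set `F` and
wrong on `F`, where the level `U` is approximately uniform near `0` and independent of `F`, which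
has probability `p`. -/
structure IsNoisyVote (ν : Measure E) (U z : E → ℝ) (F : Set E) (α p ε : ℝ) : Prop where
  pos : 0 < ε
  measurable : Measurable U
  measurableSet : MeasurableSet F
  abs_le : ∀ e, |z e| ≤ (U e ^ α)⁻¹
  of_mem : ∀ e ∈ F, U e ≤ ε → z e = -(U e ^ α)⁻¹
  of_notMem : ∀ e ∉ F, U e ≤ ε → z e = (U e ^ α)⁻¹
  le_two : ∀ v, 0 < v → v ≤ ε → ν.real {e | U e ≤ v} ≤ 2 * v
  half_le : ∀ v, 0 < v → v ≤ ε → v / 2 ≤ ν.real {e | 0 < U e ∧ U e ≤ v}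
  flip_le_two : ∀ v, 0 < v → v ≤ ε → ν.real {e | e ∈ F ∧ U e ≤ v} ≤ p * (2 * v)
  half_le_flip : ∀ v, 0 < v → v ≤ ε → p * (v / 2) ≤ ν.real {e | e ∈ F ∧ 0 < U e ∧ U e ≤ v}

theorem eventually_div_natCast_le (t : ℝ) {ε : ℝ} (hε : 0 < ε) :
    ∀ᶠ m : ℕ in atTop, t / m ≤ ε := by
  have := (tendsto_const_div_atTop_nhds_zero_nat t).eventually (gt_mem_nhds hε)
  exact this.mono fun _ h => h.le

/-- The constant depends on `α` alone because `ε` only influences how large `m` must be. At level `a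
/ m` with `a = 1 / 8`, at most `1 / 4` other points are expected; `b` is then small enough for the
weight at level `b / m` to be four times the bound on the mean weight beyond `a / m`. -/
theorem exists_forall_eventually_le (hα : 1 < α) : ∃ c : ℝ, 0 < c ∧
    ∀ {E : Type*} [MeasurableSpace E] {ν : Measure E} [IsProbabilityMeasure ν] {U z : E → ℝ}
      {F : Set E} {p ε : ℝ}, 0 < p → IsNoisyVote ν U z F α p ε →
      ∀ᶠ m : ℕ in atTop, c * p ≤ (Measure.pi fun _ : Fin m => ν).real {ω | ∑ i, z (ω i) ≤ 0} := by
  have hK := tailConst_pos hα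
  have hα0 : 0 < α := by linarith
  set a : ℝ := 1 / 8
  set r : ℝ := 2 * (tailConst α * a ^ (1 - α)) with hr
  have hr0 : 0 < r := by positivity
  set b : ℝ := min a ((4 * r) ^ (-α⁻¹)) with hb
  have hb0 : 0 < b := lt_min (by norm_num [a]) (by positivity)
  have hbr : 4 * r ≤ (b ^ α)⁻¹ := by
    rw [le_inv_comm₀ (by positivity) (by positivity)]
    calc b ^ α ≤ ((4 * r) ^ (-α⁻¹)) ^ α := by gcongr; exact min_le_right _ _
      _ = (4 * r)⁻¹ := by
        rw [← Real.rpow_mul (by positivity), neg_mul, inv_mul_cancel₀ hα0.ne', Real.rpow_neg_one]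
  refine ⟨b / 4, by positivity, fun {E} _ {ν} _ {U z F p ε} hp hV => ?_⟩
  have hscale := eventually_mul_rescaled_le (K := tailConst α) (C := ((ε / 2) ^ α)⁻¹) (t := a)
    hα (by norm_num [a]) hr0 (by rw [hr]; linarith)
  filter_upwards [hscale, eventually_div_natCast_le a hV.pos, eventually_gt_atTop 0]
    with m hm1 hm2 hm0
  obtain ⟨n, rfl⟩ : ∃ n, m = n + 1 := ⟨m - 1, by omega⟩
  have hM : (0 : ℝ) < (n + 1 : ℕ) := by positivity
  have hnM : (n : ℝ) ≤ (n + 1 : ℕ) := by push_cast; linarith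
  have hba : b / (n + 1 : ℕ) ≤ a / (n + 1 : ℕ) := by gcongr; exact min_le_left _ _
  have hb' : 0 < b / (n + 1 : ℕ) := by positivity
  have ha' : 0 < a / (n + 1 : ℕ) := hb'.trans_le hba
  have h := le_pi_real_sum_nonpos (ν := ν) (n := n) hV.measurable hα hV.abs_le hV.measurableSet hb' hba
    (fun e he hle => hV.of_mem e he (hle.trans (hba.trans hm2))) ?_ ?_
  · refine le_trans ?_ h
    have h1 := hV.half_le_flip _ hb' (hba.trans hm2)
    have h2 : ((n + 1 : ℕ) : ℝ) * (p * (b / (n + 1 : ℕ) / 2)) ≤ (n + 1 : ℕ) *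
      ν.real {e | e ∈ F ∧ 0 < U e ∧ U e ≤ b / (n + 1 : ℕ)} := by gcongr
    have h3 : ((n + 1 : ℕ) : ℝ) * (p * (b / (n + 1 : ℕ) / 2)) = p * b / 2 := by field_simp
    have h4 : ((n + 1 : ℕ) : ℝ) = n + 1 := by push_cast; ring
    rw [h3] at h2
    nth_rewrite 1 [h4] at h2
    linarith
  · have h1 := hV.le_two _ ha' hm2
    calc (n : ℝ) * ν.real {e | U e ≤ a / (n + 1 : ℕ)}
        ≤ (n + 1 : ℕ) * (2 * (a / (n + 1 : ℕ))) := by gcongr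
      _ = 1 / 4 := by field_simp; norm_num [a]
  · have h1 := integral_tailWeight_le hV.measurable hα hV.pos hV.le_two ha'
    have h0 : 0 ≤ ∫ e, tailWeight U α (a / (n + 1 : ℕ)) e ∂ν :=
      integral_nonneg fun e => tailWeight_nonneg ha' e
    calc (n : ℝ) * ∫ e, tailWeight U α (a / (n + 1 : ℕ)) e ∂ν
        ≤ (n + 1 : ℕ) * ∫ e, tailWeight U α (a / (n + 1 : ℕ)) e ∂ν := by gcongr
      _ ≤ r * ((n + 1 : ℕ) : ℝ) ^ α := le_trans (by gcongr) hm1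
      _ ≤ (b ^ α)⁻¹ / 4 * ((n + 1 : ℕ) : ℝ) ^ α := by gcongr; linarith
      _ = ((b / (n + 1 : ℕ)) ^ α)⁻¹ / 4 := by
        rw [Real.div_rpow hb0.le hM.le, inv_div]; ring

/-- The choice is `s = 2 * L / m` and `u = t / m`. A point below `s` is missing with probability at
most `exp (-L) = p`. The mean weight beyond `u` is of order `m ^ α * t ^ (1 - α)` and must be below
a fraction of `(m / L) ^ α`, which forces `t` to be of order `L ^ (α / (α - 1))`; flips below `u`
then cost `2 * t * p`. -/
theorem exists_forall_eventually_ge (hα : 1 < α) : ∃ c : ℝ, 0 < c ∧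
    ∀ {E : Type*} [MeasurableSpace E] {ν : Measure E} [IsProbabilityMeasure ν] {U z : E → ℝ}
      {F : Set E} {p ε : ℝ}, 0 < p → p < 0.49 → IsNoisyVote ν U z F α p ε →
      ∀ᶠ m : ℕ in atTop, (Measure.pi fun _ : Fin m => ν).real {ω | ∑ i, z (ω i) ≤ 0} ≤
        c * Real.log (1 / p) ^ (α / (α - 1)) * p := by
  have hK := tailConst_pos hα
  have hα0 : 0 < α := by linarith
  have hα1 : 0 < α - 1 := by linarith
  -- `A₁` makes the mean weight beyond `t / m` small enough for the Chernoff bound; `A₂` gives `A *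
  -- ℓ ≥ 4`, used for `s ≤ u` and for the Chernoff exponent.
  set A₁ : ℝ := (16 * tailConst α * 2 ^ α) ^ (α - 1)⁻¹ with hA₁
  set A₂ : ℝ := 4 * 2 ^ (α - 1)⁻¹ with hA₂
  have hA₁0 : 0 < A₁ := by positivity
  have hA₂0 : 0 < A₂ := by positivity
  set A : ℝ := A₁ + A₂ with hA
  have hA0 : 0 < A := by positivity
  have hAK : 16 * tailConst α * 2 ^ α ≤ A ^ (α - 1) := by
    calc 16 * tailConst α * 2 ^ α = A₁ ^ (α - 1) := by
          rw [hA₁, ← Real.rpow_mul (by positivity), inv_mul_cancel₀ hα1.ne', Real.rpow_one]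
      _ ≤ A ^ (α - 1) := by gcongr; linarith
  refine ⟨4 * A, by positivity, fun {E} _ {ν} _ {U z F p ε} hp hp' hV => ?_⟩
  set L := Real.log (1 / p) with hL
  -- Since `exp (1 / 2) ≤ 2` and `2 * 0.49 < 1`.
  have hLhalf : 1 / 2 ≤ L := by
    rw [hL, Real.le_log_iff_exp_le (by positivity), le_div_iff₀ hp]
    have h1 := Real.exp_bound_div_one_sub_of_interval (x := 1 / 2) (by norm_num) (by norm_num)
    norm_num at h1 hp'
    linarith [mul_le_mul h1 hp'.le hp.le (by norm_num)]
  have hL0 : 0 < L := by linarith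
  have hexpL : Real.exp (-L) = p := by
    rw [hL, one_div, Real.log_inv, neg_neg, Real.exp_log hp]
  set ℓ := L ^ (α - 1)⁻¹ with hℓ
  have hℓ0 : 0 < ℓ := by positivity
  have hℓpow : ℓ ^ (α - 1) = L := by
    rw [hℓ, ← Real.rpow_mul hL0.le, inv_mul_cancel₀ hα1.ne', Real.rpow_one]
  have hLℓ : L ^ (α / (α - 1)) = L * ℓ := by
    have : α / (α - 1) = 1 + (α - 1)⁻¹ := by field_simp; ring
    rw [this, Real.rpow_add hL0, Real.rpow_one]
  have hAℓ : 4 ≤ A * ℓ := by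
    have h1 : (1 : ℝ) ≤ 2 ^ (α - 1)⁻¹ * ℓ := by
      rw [hℓ, ← Real.mul_rpow (by norm_num) hL0.le]
      exact Real.one_le_rpow (by linarith) (by positivity)
    calc (4 : ℝ) ≤ 4 * (2 ^ (α - 1)⁻¹ * ℓ) := by linarith
      _ = A₂ * ℓ := by rw [hA₂]; ring
      _ ≤ A * ℓ := by gcongr; linarith
  set t := A * (L * ℓ) with ht
  have ht0 : 0 < t := by positivity
  have hst : 2 * L ≤ t := by
    calc 2 * L ≤ 4 * L := by linarith
      _ ≤ A * ℓ * L := by gcongr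
      _ = t := by rw [ht]; ring
  set r : ℝ := ((2 * L) ^ α)⁻¹ / 4 with hr
  have hr0 : 0 < r := by positivity
  have hscale := eventually_mul_rescaled_le (K := tailConst α) (C := ((ε / 2) ^ α)⁻¹) (t := t)
    hα ht0 hr0 (by
      have h1 : t ^ (1 - α) = (A ^ (α - 1))⁻¹ * (L ^ α)⁻¹ := by
        have h2 : L ^ α = L ^ (α - 1) * L := by
          rw [Real.rpow_sub_one hL0.ne']; field_simp
        rw [show 1 - α = -(α - 1) by ring, Real.rpow_neg ht0.le, ht,
          Real.mul_rpow hA0.le (by positivity), Real.mul_rpow hL0.le hℓ0.le, hℓpow, h2, mul_inv]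
      have h3 : tailConst α * (A ^ (α - 1))⁻¹ ≤ (2 ^ α)⁻¹ / 16 := by
        rw [← div_eq_mul_inv, div_le_iff₀ (by positivity)]
        calc tailConst α = (2 ^ α)⁻¹ / 16 * (16 * tailConst α * 2 ^ α) := by field_simp
          _ ≤ _ := by gcongr
      rw [h1, hr, Real.mul_rpow (by norm_num) hL0.le, mul_inv]
      have h4 : 0 < (L ^ α)⁻¹ := by positivity
      calc tailConst α * ((A ^ (α - 1))⁻¹ * (L ^ α)⁻¹)
          = tailConst α * (A ^ (α - 1))⁻¹ * (L ^ α)⁻¹ := by ring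
        _ ≤ (2 ^ α)⁻¹ / 16 * (L ^ α)⁻¹ := by gcongr
        _ ≤ (2 ^ α)⁻¹ * (L ^ α)⁻¹ / 4 / 2 := by
          have : 0 < (2 ^ α : ℝ)⁻¹ * (L ^ α)⁻¹ := by positivity
          linarith)
  filter_upwards [hscale, eventually_div_natCast_le t hV.pos, eventually_gt_atTop 0]
    with m hm1 hm2 hm0
  have hM : (0 : ℝ) < m := by exact_mod_cast hm0
  have hs' : 0 < 2 * L / m := by positivity
  have hst' : 2 * L / m ≤ t / m := by gcongr
  have ht' : 0 < t / m := by positivity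
  have h := pi_real_sum_nonpos_le (ν := ν) (m := m) hV.measurable hα hV.abs_le hV.measurableSet
    hs' hst' (fun e he hle => hV.of_notMem e he (hle.trans hm2)) ?_
  · refine h.trans ?_
    have h1 : m * ν.real {e | e ∈ F ∧ U e ≤ t / m} ≤ 2 * t * p := by
      calc m * ν.real {e | e ∈ F ∧ U e ≤ t / m} ≤ m * (p * (2 * (t / m))) := by
            gcongr; exact hV.flip_le_two _ ht' hm2
        _ = _ := by field_simp
    have h2 : Real.exp (-(m * ν.real {e | 0 < U e ∧ U e ≤ 2 * L / m})) ≤ p := by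
      rw [← hexpL]
      gcongr
      calc L = m * (2 * L / m / 2) := by field_simp
        _ ≤ _ := by gcongr; exact hV.half_le _ hs' (hst'.trans hm2)
    have h3 : Real.exp (-(((2 * L / m) ^ α)⁻¹ / (2 * ((t / m) ^ α)⁻¹))) ≤ p := by
      rw [← hexpL]
      gcongr
      -- The Chernoff exponent is at least `L`: of the power `α`, the part `α - 1` yields `ℓ ^ (α -
      -- 1) = L`, and the remaining factor `A * ℓ / 2 ≥ 2` cancels the division by `2`.
      have h4 : ((2 * L / m) ^ α)⁻¹ / (2 * ((t / m) ^ α)⁻¹) = (A * ℓ / 2) ^ α / 2 := by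
        have h5 : (t / m) ^ α = (A * ℓ / 2) ^ α * (2 * L / m) ^ α := by
          rw [← Real.mul_rpow (by positivity) hs'.le]
          congr 1
          rw [ht]; ring
        rw [h5]
        field_simp
      rw [h4]
      have h6 : (A * ℓ / 2) ^ α = (A * ℓ / 2) ^ (α - 1) * (A * ℓ / 2) := by
        rw [Real.rpow_sub_one (by positivity)]; field_simp
      have h7 : L ≤ (A * ℓ / 2) ^ (α - 1) := by
        rw [← hℓpow]
        have h8 : (2 : ℝ) ≤ A := by
          have : (1 : ℝ) ≤ 2 ^ (α - 1)⁻¹ := Real.one_le_rpow (by norm_num) (by positivity)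
          linarith
        gcongr
        linarith [mul_le_mul_of_nonneg_right h8 hℓ0.le]
      rw [h6]
      linarith [mul_le_mul h7 (show 2 ≤ A * ℓ / 2 by linarith) (by norm_num) (by positivity)]
    have h9 : 1 ≤ t := by linarith
    rw [hLℓ]
    calc _ ≤ 2 * t * p + p + p := by linarith
      _ ≤ 4 * t * p := by linarith [mul_le_mul_of_nonneg_right h9 hp.le]
      _ = _ := by rw [ht]; ring
  · have h1 := integral_tailWeight_le hV.measurable hα hV.pos hV.le_two ht'
    calc (m : ℝ) * ∫ e, tailWeight U α (t / m) e ∂ν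
        ≤ r * (m : ℝ) ^ α := le_trans (by gcongr) hm1
      _ = ((2 * L / m) ^ α)⁻¹ / 4 := by
        rw [Real.div_rpow (by positivity) hM.le, inv_div, hr]; ring

end Vote

/-! ### From the density near a point to a noisy vote. -/

section Law

variable {d : ℕ} {μ f : Space d → ℝ} {p : ℝ}

theorem IsDensity.isProbabilityMeasure (hμ : IsDensity μ) :
    IsProbabilityMeasure (inputLaw μ) := by
  constructor
  rw [inputLaw, withDensity_apply _ MeasurableSet.univ, Measure.restrict_univ,
    ← ofReal_integral_eq_lintegral_ofReal hμ.integrable (ae_of_all _ hμ.nonneg),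
    hμ.integral_eq_one, ENNReal.ofReal_one]

theorem isProbabilityMeasure_flipLaw (h0 : 0 ≤ p) (h1 : p ≤ 1) :
    IsProbabilityMeasure (flipLaw p) := by
  constructor
  simp only [flipLaw, Measure.add_apply, Measure.smul_apply, measure_univ, smul_eq_mul, mul_one]
  rw [← ENNReal.ofReal_add h0 (by linarith)]
  simp

theorem flipLaw_real_true (h0 : 0 ≤ p) : (flipLaw p).real {true} = p := by
  simp [flipLaw, measureReal_def, h0]

theorem inputLaw_absolutelyContinuous : inputLaw μ ≪ volume :=
  withDensity_absolutelyContinuous _ _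

theorem inputLaw_singleton (hd : 1 ≤ d) (x : Space d) : inputLaw μ {x} = 0 := by
  have : Nonempty (Fin d) := ⟨⟨0, hd⟩⟩
  exact inputLaw_absolutelyContinuous (measure_singleton x)

theorem ae_inputLaw_pos (hμ : IsDensity μ) : ∀ᵐ x ∂inputLaw μ, 0 < μ x := by
  have h : AEMeasurable (fun x => ENNReal.ofReal (μ x)) volume :=
    hμ.integrable.aestronglyMeasurable.aemeasurable.ennreal_ofReal
  rw [inputLaw, ae_withDensity_iff' h]
  exact ae_of_all _ fun x hx => by simpa using hx

/-- The volume of the ball around `x` through the input, multiplied by the density at `x`. -/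
def level (μ : Space d → ℝ) (x : Space d) (e : Space d × Bool) : ℝ :=
  μ x * volume.real (Metric.ball (0 : Space d) 1) * ‖x - e.1‖ ^ d

/-- The noisy label of an input with flip indicator. -/
def noisyLabel (f : Space d → ℝ) (e : Space d × Bool) : ℝ := if e.2 then -f e.1 else f e.1

theorem abs_noisyLabel (hf : ∀ x, f x = 1 ∨ f x = -1) (e : Space d × Bool) :
    |noisyLabel f e| = 1 := by
  unfold noisyLabel
  split <;> rcases hf e.1 with h | h <;> simp [h]

theorem volume_real_unitBall_pos : 0 < volume.real (Metric.ball (0 : Space d) 1) :=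
  ENNReal.toReal_pos (Metric.measure_ball_pos _ _ one_pos).ne' measure_ball_lt_top.ne

/-- The sublevel set at `v` is a closed ball of volume `v / μ x`. On a small ball continuity keeps
the density between `μ x / 2` and `2 * μ x`, whence the factors `1 / 2` and `2`. -/
theorem exists_level_bounds (hd : 1 ≤ d) (hμ : IsDensity μ) {x : Space d} (hx : 0 < μ x)
    (hc : ContinuousAt μ x) (hf : ∀ᶠ y in 𝓝 x, f y = f x) : ∃ ε : ℝ, 0 < ε ∧
      (∀ e, level μ x e ≤ ε → f e.1 = f x) ∧ ∀ v, 0 < v → v ≤ ε →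
        ∃ S : Set (Space d), (∀ e, level μ x e ≤ v ↔ e.1 ∈ S) ∧
          v / 2 ≤ (inputLaw μ).real S ∧ (inputLaw μ).real S ≤ 2 * v := by
  have := hμ.isProbabilityMeasure
  have hd0 : d ≠ 0 := by omega
  have hω := volume_real_unitBall_pos (d := d)
  set κ := μ x * volume.real (Metric.ball (0 : Space d) 1) with hκ
  have hκ0 : 0 < κ := by positivity
  have hnear : ∀ᶠ y in 𝓝 x, μ x / 2 < μ y ∧ μ y < 2 * μ x ∧ f y = f x :=
    (hc.eventually (lt_mem_nhds (by linarith))).and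
      ((hc.eventually (gt_mem_nhds (by linarith))).and hf)
  obtain ⟨δ, hδ, hball⟩ := Metric.nhds_basis_closedBall.eventually_iff.1 hnear
  have hlevel : ∀ (r : ℝ), 0 ≤ r → ∀ e, level μ x e ≤ κ * r ^ d ↔
      e.1 ∈ Metric.closedBall x r := by
    intro r hr e
    rw [level, ← hκ, mul_le_mul_iff_right₀ hκ0, pow_le_pow_iff_left₀ (norm_nonneg _) hr hd0,
      Metric.mem_closedBall, dist_comm, dist_eq_norm]
  refine ⟨κ * δ ^ d, by positivity, fun e he => (hball ((hlevel δ hδ.le e).1 he)).2.2,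
    fun v hv hvε => ?_⟩
  set r := (v / κ) ^ ((d : ℝ)⁻¹) with hr
  have hr0 : 0 ≤ r := by positivity
  have hrd : κ * r ^ d = v := by
    rw [hr, Real.rpow_inv_natCast_pow (by positivity) hd0]
    field_simp
  have hrδ : r ≤ δ := by
    rw [← hrd, mul_le_mul_iff_right₀ hκ0, pow_le_pow_iff_left₀ hr0 hδ.le hd0] at hvε
    exact hvε
  have hvol : volume (Metric.closedBall x r) = ENNReal.ofReal (v / μ x) := by
    rw [Measure.addHaar_closedBall _ _ hr0, finrank_euclideanSpace_fin,
      ← ENNReal.ofReal_toReal (measure_ball_lt_top (x := (0 : Space d)) (r := 1)).ne,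
      ← ENNReal.ofReal_mul (by positivity), ← measureReal_def]
    congr 1
    rw [← hrd, hκ]
    field_simp
  have hms : MeasurableSet (Metric.closedBall x r) := measurableSet_closedBall
  have hlaw : inputLaw μ (Metric.closedBall x r) =
      ∫⁻ y in Metric.closedBall x r, ENNReal.ofReal (μ y) := withDensity_apply _ hms
  have hsub := Metric.closedBall_subset_closedBall (x := x) hrδ
  refine ⟨Metric.closedBall x r, fun e => by rw [← hrd]; exact hlevel r hr0 e, ?_, ?_⟩
  · rw [measureReal_def, ← ENNReal.ofReal_le_iff_le_toReal (measure_ne_top _ _), hlaw]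
    calc ENNReal.ofReal (v / 2) = ENNReal.ofReal (μ x / 2) * ENNReal.ofReal (v / μ x) := by
          rw [← ENNReal.ofReal_mul (by positivity)]
          congr 1
          field_simp
      _ = ∫⁻ _ in Metric.closedBall x r, ENNReal.ofReal (μ x / 2) := by
          rw [setLIntegral_const, hvol]
      _ ≤ _ := setLIntegral_mono' hms fun y hy =>
          ENNReal.ofReal_le_ofReal (hball (hsub hy)).1.le
  · refine ENNReal.toReal_le_of_le_ofReal (by positivity) ?_
    rw [hlaw]
    calc ∫⁻ y in Metric.closedBall x r, ENNReal.ofReal (μ y)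
        ≤ ∫⁻ _ in Metric.closedBall x r, ENNReal.ofReal (2 * μ x) :=
          setLIntegral_mono' hms fun y hy => ENNReal.ofReal_le_ofReal (hball (hsub hy)).2.1.le
      _ = ENNReal.ofReal (2 * μ x) * ENNReal.ofReal (v / μ x) := by
          rw [setLIntegral_const, hvol]
      _ = ENNReal.ofReal (2 * v) := by
          rw [← ENNReal.ofReal_mul (by positivity)]
          congr 1
          field_simp

/-- The factor `c` turns `‖x - e.1‖ ^ (-β)` into the inverse power of the level without changing the
sign of the vote. Independence of the flip makes the relevant sets products, so flips multiply
masses by `p`; level `0` is the null set `{x}`. -/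
theorem exists_isNoisyVote (hd : 1 ≤ d) {β : ℝ} (hμ : IsDensity μ)
    (hlab : ∀ x, f x = 1 ∨ f x = -1) {x : Space d} (hx : 0 < μ x)
    (hc : ContinuousAt μ x) (hf : ∀ᶠ y in 𝓝 x, f y = f x) (h0 : 0 ≤ p) (h1 : p ≤ 1) :
    ∃ ε c : ℝ, 0 < c ∧ IsNoisyVote ((inputLaw μ).prod (flipLaw p)) (level μ x)
      (fun e => c * (f x * (noisyLabel f e / ‖x - e.1‖ ^ β))) {e | e.2 = true} (β / d) p ε := by
  have := hμ.isProbabilityMeasure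
  have := isProbabilityMeasure_flipLaw h0 h1
  have hd0 : (0 : ℝ) < d := by exact_mod_cast hd
  obtain ⟨ε, hε, hfε, hS⟩ := exists_level_bounds hd hμ hx hc hf
  have hω := volume_real_unitBall_pos (d := d)
  set κ := μ x * volume.real (Metric.ball (0 : Space d) 1) with hκ
  have hκ0 : 0 < κ := by positivity
  have hpow : ∀ e, level μ x e ^ (β / d) = κ ^ (β / d) * ‖x - e.1‖ ^ β := by
    intro e
    rw [level, ← hκ, Real.mul_rpow hκ0.le (by positivity), ← Real.rpow_natCast,
      ← Real.rpow_mul (norm_nonneg _)]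
    congr 2
    field_simp
  have hz : ∀ e, (κ ^ (β / d))⁻¹ * (f x * (noisyLabel f e / ‖x - e.1‖ ^ β)) =
      f x * noisyLabel f e * (level μ x e ^ (β / d))⁻¹ := by
    intro e
    rw [hpow, mul_inv]
    ring
  have hmeas : Measurable (level μ x) := by
    unfold level
    fun_prop
  have hfx : f x * f x = 1 := by rcases hlab x with h | h <;> simp [h]
  have hset1 : ∀ v (S : Set (Space d)), (∀ e, level μ x e ≤ v ↔ e.1 ∈ S) →
      {e | level μ x e ≤ v} = S ×ˢ Set.univ := by
    intro v S h
    ext e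
    simp [h]
  have hpos : ∀ e, 0 < level μ x e ↔ e.1 ≠ x := by
    intro e
    rw [level, ← hκ, mul_pos_iff_of_pos_left hκ0, (pow_nonneg (norm_nonneg _) d).lt_iff_ne',
      pow_ne_zero_iff (by omega), norm_ne_zero_iff, sub_ne_zero, ne_comm]
  have hset2 : ∀ v (S : Set (Space d)), (∀ e, level μ x e ≤ v ↔ e.1 ∈ S) →
      {e | 0 < level μ x e ∧ level μ x e ≤ v} = (S \ {x}) ×ˢ Set.univ := by
    intro v S h
    ext e
    simp [h, hpos, and_comm]
  have hset3 : ∀ v (S : Set (Space d)), (∀ e, level μ x e ≤ v ↔ e.1 ∈ S) →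
      {e | e ∈ {e : Space d × Bool | e.2 = true} ∧ level μ x e ≤ v} = S ×ˢ {true} := by
    intro v S h
    ext e
    simp [h, and_comm]
  have hset4 : ∀ v (S : Set (Space d)), (∀ e, level μ x e ≤ v ↔ e.1 ∈ S) →
      {e | e ∈ {e : Space d × Bool | e.2 = true} ∧ 0 < level μ x e ∧ level μ x e ≤ v} =
        (S \ {x}) ×ˢ {true} := by
    intro v S h
    ext e
    simp only [Set.mem_ofPred_eq, h, hpos, Set.mem_prod, Set.mem_sdiff, Set.mem_singleton_iff]
    tauto
  have hdiff : ∀ S : Set (Space d), (inputLaw μ).real (S \ {x}) = (inputLaw μ).real S := fun S => by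
    rw [measureReal_def, measure_sdiff_null (inputLaw_singleton hd x), measureReal_def]
  refine ⟨ε, (κ ^ (β / d))⁻¹, by positivity, hε, hmeas, ?_, ?_, ?_, ?_, ?_, ?_, ?_, ?_⟩
  · exact measurable_snd (measurableSet_singleton true)
  · intro e
    have h2 : 0 ≤ (level μ x e ^ (β / d))⁻¹ := by rw [hpow]; positivity
    have h3 : |f x| = 1 := by rcases hlab x with h | h <;> simp [h]
    simp only [hz]
    rw [abs_mul, abs_mul, abs_noisyLabel hlab, h3, abs_of_nonneg h2]
    simp
  · intro e he hle
    have he : e.2 = true := he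
    simp only [hz]
    rw [noisyLabel, if_pos he, hfε e hle, mul_neg, hfx]
    ring
  · intro e he hle
    have he : ¬ e.2 = true := he
    simp only [hz]
    rw [noisyLabel, if_neg he, hfε e hle, hfx]
    ring
  · intro v hv hvε
    obtain ⟨S, h, hlo, hhi⟩ := hS v hv hvε
    rw [hset1 v S h, measureReal_prod_prod, probReal_univ, mul_one]
    exact hhi
  · intro v hv hvε
    obtain ⟨S, h, hlo, hhi⟩ := hS v hv hvε
    rw [hset2 v S h, measureReal_prod_prod, probReal_univ, mul_one, hdiff]
    exact hlo
  · intro v hv hvε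
    obtain ⟨S, h, hlo, hhi⟩ := hS v hv hvε
    rw [hset3 v S h, measureReal_prod_prod, flipLaw_real_true h0, mul_comm]
    gcongr
  · intro v hv hvε
    obtain ⟨S, h, hlo, hhi⟩ := hS v hv hvε
    rw [hset4 v S h, measureReal_prod_prod, hdiff, flipLaw_real_true h0, mul_comm p]
    gcongr

end Law

/-! ### From pointwise failure probabilities to the clean error. -/

section CleanError

variable {d : ℕ} {μ f : Space d → ℝ} {p β : ℝ}

/-- The weighted vote of the sample at `x`, with the sign chosen such that it is positive when the
predictor agrees with `f`. -/
def margin {m : ℕ} (β : ℝ) (f : Space d → ℝ) (ω : Fin m → Space d × Bool) (x : Space d) : ℝ :=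
  ∑ i, f x * (noisyLabel f (ω i) / ‖x - (ω i).1‖ ^ β)

theorem sign_ne_iff {s y : ℝ} (hy : y = 1 ∨ y = -1) : Real.sign s ≠ y ↔ y * s ≤ 0 := by
  rcases lt_trichotomy s 0 with h | h | h
  · rw [Real.sign_of_neg h]
    rcases hy with rfl | rfl
    · exact iff_of_true (by norm_num) (by linarith)
    · exact iff_of_false (by norm_num) (by linarith)
  · subst h
    rcases hy with rfl | rfl <;> simp
  · rw [Real.sign_of_pos h]
    rcases hy with rfl | rfl
    · exact iff_of_false (by norm_num) (by linarith)
    · exact iff_of_true (by norm_num) (by linarith)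

/-- The sample points form a null set, so the interpolating branch of `predictor` does not affect
the error. A zero sum counts as an error, hence the non-strict inequality. -/
theorem inputLaw_error_eq (hd : 1 ≤ d) (hlab : ∀ x, f x = 1 ∨ f x = -1) {m : ℕ}
    (ω : Fin m → Space d × Bool) :
    inputLaw μ {x | predictor β (labelled f ω) x ≠ f x} = inputLaw μ {x | margin β f ω x ≤ 0} := by
  have hne : ∀ᵐ x ∂inputLaw μ, ∀ i, x ≠ (ω i).1 :=
    ae_all_iff.2 fun i => measure_eq_zero_iff_ae_notMem.1 (inputLaw_singleton hd (ω i).1)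
  refine measure_congr (eventuallyEq_set.2 ?_)
  filter_upwards [hne] with x hx
  have h : ¬ ∃ i, x = (labelled f ω i).1 := by
    rintro ⟨i, hi⟩
    exact hx i hi
  simp only [predictor, dif_neg h]
  rw [sign_ne_iff (hlab x), Finset.mul_sum]
  rfl

theorem measurable_margin (hf : Measurable f) (m : ℕ) :
    Measurable fun q : (Fin m → Space d × Bool) × Space d => margin β f q.1 q.2 := by
  have hn : Measurable (noisyLabel f) :=
    Measurable.ite (measurable_snd (measurableSet_singleton true)) (hf.comp measurable_fst).neg
      (hf.comp measurable_fst)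
  unfold margin
  fun_prop

/-- Tonelli's theorem, which lets the test point be fixed before the sample is drawn. -/
theorem cleanError_eq_of_measurable (hd : 1 ≤ d) (hμ : IsDensity μ)
    (hlab : ∀ x, f x = 1 ∨ f x = -1) (hf : Measurable f) (h0 : 0 ≤ p) (h1 : p ≤ 1) (m : ℕ) :
    Measurable (fun x => sampleLaw μ p m {ω | margin β f ω x ≤ 0}) ∧
    cleanError β μ f p m = ∫⁻ x, sampleLaw μ p m {ω | margin β f ω x ≤ 0} ∂inputLaw μ := by
  have := hμ.isProbabilityMeasure
  have := isProbabilityMeasure_flipLaw h0 h1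
  have : IsProbabilityMeasure (sampleLaw μ p m) := by unfold sampleLaw; infer_instance
  have hS : MeasurableSet {q : (Fin m → Space d × Bool) × Space d | margin β f q.1 q.2 ≤ 0} :=
    measurableSet_le (measurable_margin hf m) measurable_const
  refine ⟨measurable_measure_prodMk_right hS, ?_⟩
  unfold cleanError
  simp_rw [inputLaw_error_eq hd hlab]
  exact (Measure.prod_apply hS).symm.trans (Measure.prod_apply_symm hS)

/-- A measurable version of a target function that is locally constant almost everywhere. -/
def measurableLabel (f : Space d → ℝ) : Space d → ℝ :=
  open Classical in fun x => if x ∈ interior {y | f y = 1} then 1 else -1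

theorem measurable_measurableLabel : Measurable (measurableLabel f) := by
  classical
  exact Measurable.ite isOpen_interior.measurableSet measurable_const measurable_const

theorem measurableLabel_eq (hlab : ∀ x, f x = 1 ∨ f x = -1) {x : Space d}
    (hx : ∀ᶠ y in 𝓝 x, f y = f x) : measurableLabel f x = f x := by
  unfold measurableLabel
  rcases hlab x with h | h
  · rw [if_pos, h]
    rw [mem_interior_iff_mem_nhds]
    filter_upwards [hx] with y hy
    exact hy.trans h
  · rw [if_neg, h]
    intro hmem
    have : f x = 1 := interior_subset (s := {y | f y = 1}) hmem
    linarith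

theorem Admissible.measurableLabel_ae_eq (h : Admissible μ f) : measurableLabel f =ᵐ[volume] f :=
  h.locallyConstant.mono fun _ hx => measurableLabel_eq h.label hx

theorem Admissible.measurableLabel (h : Admissible μ f) : Admissible μ (measurableLabel f) where
  isDensity := h.isDensity
  label x := by
    unfold NadarayaWatson.measurableLabel
    split <;> simp
  continuousAt := h.continuousAt
  locallyConstant := by
    filter_upwards [h.locallyConstant] with x hx
    -- Local constancy at `x` passes to all nearby `y`, so the two labels agree on a whole
    -- neighbourhood.
    filter_upwards [eventually_eventually_nhds.2 hx, hx] with y hy hyx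
    rw [measurableLabel_eq h.label hx, ← hyx]
    refine measurableLabel_eq h.label ?_
    rw [hyx]
    exact hy

/-- The target is not assumed measurable, so this is what permits passing to `measurableLabel`
before Tonelli is applied: almost surely neither the sample labels nor the error set changes, up to
a null set. -/
theorem cleanError_congr {g : Space d → ℝ} (hμ : IsDensity μ) (hfg : f =ᵐ[volume] g)
    (h0 : 0 ≤ p) (h1 : p ≤ 1) (m : ℕ) : cleanError β μ f p m = cleanError β μ g p m := by
  have := hμ.isProbabilityMeasure
  have := isProbabilityMeasure_flipLaw h0 h1
  have hae : ∀ᵐ x ∂inputLaw μ, f x = g x := inputLaw_absolutelyContinuous.ae_le hfg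
  have hsample : ∀ᵐ ω ∂sampleLaw μ p m, ∀ i, f (ω i).1 = g (ω i).1 := by
    refine ae_all_iff.2 fun i => ?_
    have h2 : ∀ᵐ e ∂(inputLaw μ).prod (flipLaw p), f e.1 = g e.1 :=
      Measure.quasiMeasurePreserving_fst.ae hae
    exact (Measure.quasiMeasurePreserving_eval (fun _ : Fin m => (inputLaw μ).prod (flipLaw p))
      i).ae h2
  refine lintegral_congr_ae ?_
  filter_upwards [hsample] with ω hω
  have hlab : labelled f ω = labelled g ω := by
    funext i
    simp only [labelled, hω i]
  rw [hlab]
  refine measure_congr (eventuallyEq_set.2 ?_)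
  filter_upwards [hae] with x hx
  simp only [hx]

/-- The pointwise bounds hold only from some `m` depending on `x`. Fatou's lemma suffices for the
lower bound, and its reverse, with probabilities dominated by `1`, for the upper. -/
theorem Admissible.cleanError_bounds (hd : 1 ≤ d) (h : Admissible μ f)
    (h0 : 0 ≤ p) (h1 : p ≤ 1) {lo hi : ℝ}
    (hbd : ∀ (z : Space d × Bool → ℝ) (U : Space d × Bool → ℝ) (ε : ℝ),
      IsNoisyVote ((inputLaw μ).prod (flipLaw p)) U z {e | e.2 = true} (β / d) p ε →
      ∀ᶠ m : ℕ in atTop, lo ≤ (sampleLaw μ p m).real {ω | ∑ i, z (ω i) ≤ 0} ∧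
        (sampleLaw μ p m).real {ω | ∑ i, z (ω i) ≤ 0} ≤ hi) :
    ENNReal.ofReal lo ≤ liminf (cleanError β μ f p) atTop ∧
      limsup (cleanError β μ f p) atTop ≤ ENNReal.ofReal hi := by
  have hμ := h.isDensity
  have := hμ.isProbabilityMeasure
  have := isProbabilityMeasure_flipLaw h0 h1
  have hprob : ∀ m, IsProbabilityMeasure (sampleLaw μ p m) := fun m => by
    unfold sampleLaw; infer_instance
  set g := NadarayaWatson.measurableLabel f with hg
  have hgA : Admissible μ g := h.measurableLabel
  have hgm : Measurable g := measurable_measurableLabel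
  have herr : cleanError β μ f p =
      fun m => ∫⁻ x, sampleLaw μ p m {ω | margin β g ω x ≤ 0} ∂inputLaw μ := by
    funext m
    rw [cleanError_congr hμ h.measurableLabel_ae_eq.symm h0 h1 m]
    exact (cleanError_eq_of_measurable hd hμ hgA.label hgm h0 h1 m).2
  have hmeas : ∀ m, Measurable fun x => sampleLaw μ p m {ω | margin β g ω x ≤ 0} := fun m =>
    (cleanError_eq_of_measurable hd hμ hgA.label hgm h0 h1 m).1
  have hpt : ∀ᵐ x ∂inputLaw μ, ∀ᶠ m : ℕ in atTop,
      ENNReal.ofReal lo ≤ sampleLaw μ p m {ω | margin β g ω x ≤ 0} ∧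
        sampleLaw μ p m {ω | margin β g ω x ≤ 0} ≤ ENNReal.ofReal hi := by
    filter_upwards [ae_inputLaw_pos hμ, inputLaw_absolutelyContinuous.ae_le hgA.continuousAt,
      inputLaw_absolutelyContinuous.ae_le hgA.locallyConstant] with x hx hxc hxf
    obtain ⟨ε, c, hc, hV⟩ := exists_isNoisyVote hd hμ hgA.label hx hxc hxf h0 h1
    filter_upwards [hbd _ _ _ hV] with m hm
    have hset : {ω : Fin m → Space d × Bool | ∑ i, c * (g x * (noisyLabel g (ω i) /
        ‖x - (ω i).1‖ ^ β)) ≤ 0} = {ω | margin β g ω x ≤ 0} := by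
      ext ω
      simp only [Set.mem_ofPred_eq, ← Finset.mul_sum]
      rw [margin, ← Finset.mul_sum]
      exact ⟨fun h => not_lt.1 fun hn => h.not_gt (mul_pos hc hn),
        mul_nonpos_of_nonneg_of_nonpos hc.le⟩
    rw [hset] at hm
    rw [← ofReal_measureReal]
    exact ⟨ENNReal.ofReal_le_ofReal hm.1, ENNReal.ofReal_le_ofReal hm.2⟩
  rw [herr]
  constructor
  · refine le_trans ?_ (lintegral_liminf_le hmeas)
    calc ENNReal.ofReal lo = ∫⁻ _, ENNReal.ofReal lo ∂inputLaw μ := by simp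
      _ ≤ _ := lintegral_mono_ae (hpt.mono fun x hx =>
          le_liminf_of_le (by isBoundedDefault) (hx.mono fun _ hm => hm.1))
  · refine (limsup_lintegral_le (fun _ => 1) hmeas (fun m => ae_of_all _ fun x => prob_le_one)
      (by simp)).trans ?_
    calc _ ≤ ∫⁻ _, ENNReal.ofReal hi ∂inputLaw μ := lintegral_mono_ae (hpt.mono fun x hx =>
          limsup_le_of_le (by isBoundedDefault) (hx.mono fun _ hm => hm.2))
      _ = ENNReal.ofReal hi := by simp

theorem cleanError_le_one (hμ : IsDensity μ) (h0 : 0 ≤ p) (h1 : p ≤ 1) (m : ℕ) :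
    cleanError β μ f p m ≤ 1 := by
  have := hμ.isProbabilityMeasure
  have := isProbabilityMeasure_flipLaw h0 h1
  have : IsProbabilityMeasure (sampleLaw μ p m) := by unfold sampleLaw; infer_instance
  calc cleanError β μ f p m ≤ ∫⁻ _, 1 ∂sampleLaw μ p m := lintegral_mono fun _ => prob_le_one
    _ = 1 := by simp

/-- A Gaussian density with a constant target; refuting benign overfitting needs at least one
admissible pair. -/
theorem exists_admissible (d : ℕ) : ∃ μ f : Space d → ℝ, Admissible μ f := by
  have hint : ∫ x : Space d, Real.exp (-Real.pi * ‖x‖ ^ 2) = 1 := by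
    rw [GaussianFourier.integral_rexp_neg_mul_sq_norm Real.pi_pos, div_self Real.pi_ne_zero,
      Real.one_rpow]
  refine ⟨fun x => Real.exp (-Real.pi * ‖x‖ ^ 2), fun _ => 1, ⟨fun x => (Real.exp_pos _).le,
    Integrable.of_integral_ne_zero (by rw [hint]; norm_num), hint⟩, fun _ => Or.inl rfl, ?_, ?_⟩
  · refine ae_of_all _ fun x => Continuous.continuousAt ?_
    fun_prop
  · exact ae_of_all _ fun x => Eventually.of_forall fun _ => rfl

end CleanError

/-! ### Elementary inequalities and the conclusion. -/

/-- The base is at least `1`, as `2 ^ α ≥ 1 + α * log 2` and `8 * log 2 > 1`. Hence `p ^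
lowerExponent α ≤ p`. -/
theorem one_le_lowerExponent {α : ℝ} (hα : 1 < α) : 1 ≤ lowerExponent α := by
  have h1 : (1 : ℝ) ≤ 2 ^ α := Real.one_le_rpow (by norm_num) (by linarith)
  have h2 : α - 1 ≤ 8 * 2 ^ α := by
    have h3 : (2 : ℝ) ^ α = Real.exp (Real.log 2 * α) := Real.rpow_def_of_pos (by norm_num) α
    have h4 := Real.add_one_le_exp (Real.log 2 * α)
    have h5 := Real.log_two_gt_d9
    nlinarith
  refine Real.one_le_rpow ?_ (by rw [one_div, inv_nonneg]; linarith)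
  rwa [le_div_iff₀ (by linarith), one_mul]

/-- This supplies the monotone continuous majorant for temperedness. It follows from `log y ≤ 2 * γ
* y ^ (1 / (2 * γ))` at `y = 1 / p`, raised to the power `γ`. -/
theorem log_rpow_mul_le {γ p : ℝ} (hγ : 0 < γ) (hp : 0 < p) (hp1 : p ≤ 1) :
    Real.log (1 / p) ^ γ * p ≤ (2 * γ) ^ γ * √p := by
  have h1 := Real.log_le_rpow_div (x := 1 / p) (ε := (2 * γ)⁻¹) (by positivity) (by positivity)
  have h0 : 0 ≤ Real.log (1 / p) := Real.log_nonneg (by rw [le_div_iff₀ hp]; linarith)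
  have h2 : Real.log (1 / p) ^ γ ≤ (√p)⁻¹ * (2 * γ) ^ γ := by
    calc Real.log (1 / p) ^ γ ≤ ((1 / p) ^ (2 * γ)⁻¹ / (2 * γ)⁻¹) ^ γ := by gcongr
      _ = (√p)⁻¹ * (2 * γ) ^ γ := by
        rw [div_inv_eq_mul, Real.mul_rpow (by positivity) (by positivity),
          ← Real.rpow_mul (by positivity), one_div, ← Real.sqrt_inv, Real.sqrt_eq_rpow]
        congr 2
        field_simp
  have h3 : 0 < √p := Real.sqrt_pos.2 hp
  calc Real.log (1 / p) ^ γ * p ≤ (√p)⁻¹ * (2 * γ) ^ γ * p := by gcongr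
    _ = (√p)⁻¹ * (2 * γ) ^ γ * (√p * √p) := by rw [Real.mul_self_sqrt hp.le]
    _ = _ := by field_simp

end NadarayaWatson

end

theorem theorem4p1 :
    ∃ C₁ C₂ : ℝ → ℝ,
      (∀ α : ℝ, 1 < α → 0 < C₁ α ∧ 0 < C₂ α ∧ 0 < NadarayaWatson.lowerExponent α) ∧
      ∀ d : ℕ, 1 ≤ d → ∀ β : ℝ, (d : ℝ) < β →
        (∀ μ f : NadarayaWatson.Space d → ℝ, NadarayaWatson.Admissible μ f →
          ∀ p : ℝ, 0 < p → p < 0.49 →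
            ENNReal.ofReal (C₁ (β / d) * p ^ NadarayaWatson.lowerExponent (β / d)) ≤
              liminf (NadarayaWatson.cleanError β μ f p) atTop ∧
            limsup (NadarayaWatson.cleanError β μ f p) atTop ≤
              ENNReal.ofReal (C₂ (β / d) * Real.log (1 / p) ^ (1 / (1 - d / β)) * p)) ∧
        NadarayaWatson.IsTempered d β := by
  open NadarayaWatson in
  -- Stated for every real `α`, with the dummy value `0` when `α ≤ 1`, so that the constants can be
  -- chosen as functions of `α` before `d`, `β`, `μ` and `f`.
  have hlow : ∀ α : ℝ, ∃ c : ℝ, 1 < α → 0 < c ∧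
      ∀ {E : Type} [MeasurableSpace E] {ν : Measure E} [IsProbabilityMeasure ν] {U z : E → ℝ}
        {F : Set E} {p ε : ℝ}, 0 < p → IsNoisyVote ν U z F α p ε →
        ∀ᶠ m : ℕ in atTop,
          c * p ≤ (Measure.pi fun _ : Fin m => ν).real {ω | ∑ i, z (ω i) ≤ 0} := by
    intro α
    by_cases hα : 1 < α
    · obtain ⟨c, hc, h⟩ := exists_forall_eventually_le hα
      exact ⟨c, fun _ => ⟨hc, h⟩⟩
    · exact ⟨0, fun h => absurd h hα⟩
  have hupp : ∀ α : ℝ, ∃ c : ℝ, 1 < α → 0 < c ∧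
      ∀ {E : Type} [MeasurableSpace E] {ν : Measure E} [IsProbabilityMeasure ν] {U z : E → ℝ}
        {F : Set E} {p ε : ℝ}, 0 < p → p < 0.49 → IsNoisyVote ν U z F α p ε →
        ∀ᶠ m : ℕ in atTop, (Measure.pi fun _ : Fin m => ν).real {ω | ∑ i, z (ω i) ≤ 0} ≤
          c * Real.log (1 / p) ^ (α / (α - 1)) * p := by
    intro α
    by_cases hα : 1 < α
    · obtain ⟨c, hc, h⟩ := exists_forall_eventually_ge hα
      exact ⟨c, fun _ => ⟨hc, h⟩⟩
    · exact ⟨0, fun h => absurd h hα⟩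
  choose C₁ hC₁ using hlow
  choose C₂ hC₂ using hupp
  refine ⟨C₁, C₂, fun α hα => ⟨(hC₁ α hα).1, (hC₂ α hα).1,
    one_pos.trans_le (one_le_lowerExponent hα)⟩, fun d hd β hβ => ?_⟩
  have hd0 : (0 : ℝ) < d := by exact_mod_cast hd
  have hβ0 : 0 < β := hd0.trans hβ
  have hα : 1 < β / d := (one_lt_div hd0).2 hβ
  obtain ⟨hc₁, hlow⟩ := hC₁ _ hα
  obtain ⟨hc₂, hupp⟩ := hC₂ _ hα
  have hexp : β / d / (β / d - 1) = 1 / (1 - d / β) := by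
    have : β - d ≠ 0 := by linarith
    field_simp
  rw [hexp] at hupp
  have hmain : ∀ μ f : Space d → ℝ, Admissible μ f → ∀ p : ℝ, 0 < p → p < 0.49 →
      ENNReal.ofReal (C₁ (β / d) * p) ≤ liminf (cleanError β μ f p) atTop ∧
        limsup (cleanError β μ f p) atTop ≤
          ENNReal.ofReal (C₂ (β / d) * Real.log (1 / p) ^ (1 / (1 - d / β)) * p) := by
    intro μ f h p hp hp'
    have hp1 : p ≤ 1 := by norm_num at hp'; linarith
    have := h.isDensity.isProbabilityMeasure
    have := isProbabilityMeasure_flipLaw hp.le hp1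
    exact h.cleanError_bounds hd hp.le hp1 fun z U ε hV =>
      (hlow hp hV).and (hupp hp hp' hV)
  refine ⟨fun μ f h p hp hp' => ⟨le_trans (ENNReal.ofReal_le_ofReal ?_) (hmain μ f h p hp hp').1,
    (hmain μ f h p hp hp').2⟩, ?_, ?_⟩
  · have hp1 : p ≤ 1 := by norm_num at hp'; linarith
    gcongr
    calc p ^ lowerExponent (β / d) ≤ p ^ (1 : ℝ) :=
          Real.rpow_le_rpow_of_exponent_ge hp hp1 (one_le_lowerExponent hα)
      _ = p := Real.rpow_one p
  · intro p hp hp' hben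
    obtain ⟨μ, f, h⟩ := exists_admissible d
    have h1 := (hmain μ f h p hp hp').1
    rw [(hben μ f h).liminf_eq, nonpos_iff_eq_zero, ENNReal.ofReal_eq_zero] at h1
    have : 0 < C₁ (β / d) * p := by positivity
    linarith
  · set γ := 1 / (1 - d / β) with hγ
    have hγ0 : 0 < γ := one_div_pos.2 (sub_pos.2 ((div_lt_one hβ0).2 hβ))
    set K := C₂ (β / d) * (2 * γ) ^ γ with hK
    have hK0 : 0 < K := by positivity
    -- The cap at `1` keeps the values in `[0, 1]`; it is harmless as the clean error never exceeds
    -- `1`.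
    refine ⟨fun p => min 1 (K * √p), ?_, ?_, ?_, by simp, fun p hp hp' μ f h => ?_⟩
    · exact fun p _ => ⟨le_min zero_le_one (by positivity), min_le_left _ _⟩
    · intro p _ q _ hpq
      exact min_le_min le_rfl (by gcongr)
    · exact Continuous.continuousOn (by fun_prop)
    · have hp1 : p ≤ 1 := by norm_num at hp'; linarith
      rw [ENNReal.ofReal_min, le_min_iff]
      constructor
      · rw [ENNReal.ofReal_one]
        exact limsup_le_of_le (by isBoundedDefault)
          (Eventually.of_forall fun m => cleanError_le_one h.isDensity hp.le hp1 m)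
      · refine (hmain μ f h p hp hp').2.trans (ENNReal.ofReal_le_ofReal ?_)
        rw [mul_assoc, hK, mul_assoc]
        exact mul_le_mul_of_nonneg_left (log_rpow_mul_le hγ0 hp hp1) hc₂.le
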